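/- Let $n\ge 2$, $2\le p\le\infty$ and $0<T<\infty$, and put $\Delta_p w=\operatorname{div}(|Dw|^{p-2}Dw)$ for $p<\infty$ and $\Delta_\infty w=\sum_{i,j=1}^n D_iw\,D_jw\,D_{ij}w$, where the derivatives are taken in $x\in\mathbb{R}^n$ only. Consider the equation $$\Gamma_p u:=\Delta_p u-(p-1)u^{p-2}u_t=0\ \ (2\le p<\infty),\qquad \Gamma_\infty u:=\Delta_\infty u-3u^2u_t=0\ \ (p=\infty).$$ A continuous function $u>0$ on $\mathbb{R}^n\times(0,T)$ is a (viscosity) solution of $\Gamma_p u=0$ in $\mathbb{R}^n\times(0,T)$ if, for every function $\psi$ on $\mathbb{R}^n\times(0,T)$ that is $C^2$ in $x$ and $C^1$ in $t$ (that is, $\psi, D\psi, D^2\psi,\psi_t$ exist and are continuous) and every $(y,s)\in\mathbb{R}^n\times(0,T)$, $$\Delta_p\psi(y,s)-(p-1)u(y,s)^{p-2}\psi_t(y,s)\ \ge 0\ \text{ if } u-\psi \text{ has a local maximum at } (y,s),\qquad \le 0\ \text{ if } u-\psi\text{ has a local minimum at }(y,s),$$ with the left-hand side replaced by $\Delta_\infty\psi(y,s)-3u(y,s)^2\psi_t(y,s)$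 when $p=\infty$. Let $f:\mathbb{R}^n\to\mathbb{R}$ satisfy $0<\inf_{\mathbb{R}^n} f\le\sup_{\mathbb{R}^n} f<\infty$. Suppose that $u\in C(\mathbb{R}^n\times[0,T))$ is a positive viscosity solution of $\Gamma_p u=0$ in $\mathbb{R}^n\times(0,T)$ with $u(x,0)=f(x)$ for all $x\in\mathbb{R}^n$, and that, as $R\to\infty$, $$\sup_{|x|\le R,\ 0\le t<T}u(x,t)\le\begin{cases}\exp\big(o(R^{p/(p-1)})\big), & 2\le p<\infty,\\ \exp\big(o(R^{4/3})\big), & p=\infty.\end{cases}$$ Then $$\inf_{\mathbb{R}^n}f\ \le\ u(x,t)\ \le\ \sup_{\mathbb{R}^n}f\qquad\text{for all }(x,t)\in\mathbb{R}^n\times(0,T).$$ -/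

import Mathlib

open Set Filter Topology Asymptotics
open scoped ENNReal

noncomputable section

namespace Trudinger

/-- The divergence of a vector field on `ℝⁿ`. -/
def divergence {n : ℕ} (V : EuclideanSpace ℝ (Fin n) → EuclideanSpace ℝ (Fin n))
    (x : EuclideanSpace ℝ (Fin n)) : ℝ :=
  ∑ i, fderiv ℝ V x (EuclideanSpace.single i 1) i

/-- The partial derivative `Dᵢ w`. -/
def partialDeriv {n : ℕ} (i : Fin n) (w : EuclideanSpace ℝ (Fin n) → ℝ)
    (x : EuclideanSpace ℝ (Fin n)) : ℝ :=
  fderiv ℝ w x (EuclideanSpace.single i 1)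

/-- The `p`-Laplacian `Δ_p w = div (|Dw|^{p-2} Dw)`.  For `p ≥ 2` and `w` of class `C²` the field
`|Dw|^{p-2} Dw` is differentiable, also at the zeros of `Dw` (and `0 ^ 0 = 1`, so `Δ_2 = Δ`). -/
def pLaplacian {n : ℕ} (p : ℝ) (w : EuclideanSpace ℝ (Fin n) → ℝ)
    (x : EuclideanSpace ℝ (Fin n)) : ℝ :=
  divergence (fun y => ‖gradient w y‖ ^ (p - 2) • gradient w y) x

/-- The infinity-Laplacian `Δ_∞ w = ∑ᵢⱼ Dᵢw Dⱼw Dᵢⱼw`. -/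
def inftyLaplacian {n : ℕ} (w : EuclideanSpace ℝ (Fin n) → ℝ)
    (x : EuclideanSpace ℝ (Fin n)) : ℝ :=
  ∑ i, ∑ j, partialDeriv i w x * partialDeriv j w x * partialDeriv i (partialDeriv j w) x

/-- The expression `Δ_p ψ - (p-1) c^{p-2} ψ_t` (for `p = ∞`: `Δ_∞ ψ - 3 c² ψ_t`) at the
point `z = (y, s)`; the operator `Γ_p` is the case `ψ = u`, `c = u(y, s)`. -/
def gammaAt {n : ℕ} (p : ℝ≥0∞) (c : ℝ) (ψ : EuclideanSpace ℝ (Fin n) × ℝ → ℝ)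
    (z : EuclideanSpace ℝ (Fin n) × ℝ) : ℝ :=
  if p = ∞ then
    inftyLaplacian (fun x => ψ (x, z.2)) z.1 - 3 * c ^ 2 * deriv (fun t => ψ (z.1, t)) z.2
  else
    pLaplacian p.toReal (fun x => ψ (x, z.2)) z.1
      - (p.toReal - 1) * c ^ (p.toReal - 2) * deriv (fun t => ψ (z.1, t)) z.2

/-- The open cylinder `Ω_T = Ω × (0, T)`. -/
def cylinder {n : ℕ} (Ω : Set (EuclideanSpace ℝ (Fin n))) (T : ℝ) :
    Set (EuclideanSpace ℝ (Fin n) × ℝ) :=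
  Ω ×ˢ Ioo 0 T

/-- `ψ` is `C²` in `x` and `C¹` in `t` on `Ω_T` (`Ω` open): the functions `ψ`, `Dψ`, `D²ψ`, `ψ_t`
exist and are continuous on `Ω_T`. -/
structure IsC21On {n : ℕ} (ψ : EuclideanSpace ℝ (Fin n) × ℝ → ℝ)
    (Ω : Set (EuclideanSpace ℝ (Fin n))) (T : ℝ) : Prop where
  contDiff_space : ∀ t ∈ Ioo 0 T, ContDiffOn ℝ 2 (fun x => ψ (x, t)) Ω
  contDiff_time : ∀ x ∈ Ω, ContDiffOn ℝ 1 (fun t => ψ (x, t)) (Ioo 0 T)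
  continuousOn : ContinuousOn ψ (cylinder Ω T)
  continuousOn_space : ContinuousOn (fun z : EuclideanSpace ℝ (Fin n) × ℝ =>
    fderiv ℝ (fun x => ψ (x, z.2)) z.1) (cylinder Ω T)
  continuousOn_space_space : ContinuousOn (fun z : EuclideanSpace ℝ (Fin n) × ℝ =>
    fderiv ℝ (fderiv ℝ (fun x => ψ (x, z.2))) z.1) (cylinder Ω T)
  continuousOn_time : ContinuousOn (fun z : EuclideanSpace ℝ (Fin n) × ℝ =>
    deriv (fun t => ψ (z.1, t)) z.2) (cylinder Ω T)

/-- `u` is a positive viscosity sub-solution of `Γ_p w = 0` in `Ω_T`, that is, `Γ_p u ≥ 0`. -/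
structure IsSubsolution {n : ℕ} (p : ℝ≥0∞) (Ω : Set (EuclideanSpace ℝ (Fin n))) (T : ℝ)
    (u : EuclideanSpace ℝ (Fin n) × ℝ → ℝ) : Prop where
  usc : UpperSemicontinuousOn u (cylinder Ω T)
  pos : ∀ z ∈ cylinder Ω T, 0 < u z
  test : ∀ ψ : EuclideanSpace ℝ (Fin n) × ℝ → ℝ, IsC21On ψ Ω T → ∀ z ∈ cylinder Ω T,
    IsLocalMaxOn (fun w => u w - ψ w) (cylinder Ω T) z → 0 ≤ gammaAt p (u z) ψ z

/-- `u` is a positive viscosity super-solution of `Γ_p w = 0` in `Ω_T`, that is, `Γ_p u ≤ 0`. -/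
structure IsSupersolution {n : ℕ} (p : ℝ≥0∞) (Ω : Set (EuclideanSpace ℝ (Fin n))) (T : ℝ)
    (u : EuclideanSpace ℝ (Fin n) × ℝ → ℝ) : Prop where
  lsc : LowerSemicontinuousOn u (cylinder Ω T)
  pos : ∀ z ∈ cylinder Ω T, 0 < u z
  test : ∀ ψ : EuclideanSpace ℝ (Fin n) × ℝ → ℝ, IsC21On ψ Ω T → ∀ z ∈ cylinder Ω T,
    IsLocalMinOn (fun w => u w - ψ w) (cylinder Ω T) z → gammaAt p (u z) ψ z ≤ 0

/-- `u` is a positive viscosity solution of `Γ_p u = 0` in `Ω_T`. -/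
structure IsSolution {n : ℕ} (p : ℝ≥0∞) (Ω : Set (EuclideanSpace ℝ (Fin n))) (T : ℝ)
    (u : EuclideanSpace ℝ (Fin n) × ℝ → ℝ) : Prop where
  continuousOn : ContinuousOn u (cylinder Ω T)
  sub : IsSubsolution p Ω T u
  super : IsSupersolution p Ω T u

/-- The growth exponent: `p/(p-1)` for `p < ∞`, and `4/3` for `p = ∞`. -/
def growthExponent (p : ℝ≥0∞) : ℝ :=
  if p = ∞ then 4 / 3 else p.toReal / (p.toReal - 1)

end Trudinger

end

namespace Trudinger

variable {n : ℕ}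

local notation "E" => EuclideanSpace ℝ (Fin n)

/-! Both bounds come from comparing `u` with an explicit smooth barrier, so no comparison principle
between two viscosity solutions is needed. `Γ_p` is homogeneous, so any positive multiple of a
barrier `exp v` may serve as test function. At an interior extremum of the quotient of `u` and `exp
v`, the multiple touching `u` contradicts a strict inequality for `v`, in which `u` no longer
appears (`sub_test`, `super_test`).

Upper bound: `v = η/(T'-t) + ε(1+t)(1+|x|²)^(γ/2)` with `γ = q/(q-1)`. This `γ` makes the leading
spatial term grow like `v_t`, with coefficient of order `ε^q` against `ε`; the remaining spatial
term is bounded and is absorbed by `η/(T'-t)²` (`upper_barrier_bound`). The growth hypothesis puts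
`u` below the barrier on `|x| = R` for large `R`.

Lower bound: `v = -η/(T'-t) + k log(R²-|x|²)`. Here `exp v` vanishes on `|x| = R`, so no growth
condition enters, and its defect is `O(R⁻²)` (`lower_barrier_bound`).

In both cases the `η` term closes the cylinder at `T' < T`. Letting `R → ∞` in the lower bound,
choosing `ε ≤ η` in the upper one, and then letting `η → 0` leaves the initial bounds. -/

/-! ### Locally defined test functions. -/

theorem IsC21On.of_contDiff {ψ : E × ℝ → ℝ} (hψ : ContDiff ℝ 2 ψ) (T : ℝ) :
    IsC21On ψ univ T := by
  have h1 : ContDiff ℝ 1 (fun z : E × ℝ => fderiv ℝ (fun x => ψ (x, z.2)) z.1) :=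
    ContDiff.fderiv (f := fun (z : E × ℝ) (x : E) => ψ (x, z.2)) (m := 2) (n := 1)
      (hψ.comp (contDiff_snd.prodMk (contDiff_snd.comp contDiff_fst))) contDiff_fst one_add_one_eq_two.le
  have h2 : ContDiff ℝ 0 (fun z : E × ℝ => fderiv ℝ (fderiv ℝ (fun x => ψ (x, z.2))) z.1) :=
    ContDiff.fderiv (f := fun (z : E × ℝ) (x : E) => fderiv ℝ (fun x' => ψ (x', z.2)) x)
      (m := 1) (n := 0)
      (h1.comp (contDiff_snd.prodMk (contDiff_snd.comp contDiff_fst))) contDiff_fst (by norm_num)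
  have h3 : ContDiff ℝ 1 (fun z : E × ℝ => fderiv ℝ (fun t => ψ (z.1, t)) z.2) :=
    ContDiff.fderiv (f := fun (z : E × ℝ) (t : ℝ) => ψ (z.1, t)) (m := 2) (n := 1)
      (hψ.comp ((contDiff_fst.comp contDiff_fst).prodMk contDiff_snd)) contDiff_snd one_add_one_eq_two.le
  refine ⟨fun t _ => (hψ.comp (contDiff_id.prodMk contDiff_const)).contDiffOn,
    fun x _ => ((hψ.comp (contDiff_const.prodMk contDiff_id)).of_le (by norm_num)).contDiffOn,
    hψ.continuous.continuousOn, h1.continuous.continuousOn, h2.continuous.continuousOn, ?_⟩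
  have : (fun z : E × ℝ => deriv (fun t => ψ (z.1, t)) z.2) =
      fun z => fderiv ℝ (fun t => ψ (z.1, t)) z.2 1 := by
    funext z; exact (fderiv_apply_one_eq_deriv).symm
  rw [this]
  exact (h3.continuous.clm_apply continuous_const).continuousOn

/-- A bump function extends a local test function by zero. This is needed because the definition
asks for test functions on the whole cylinder, while the barriers are singular at `t = T'` or `|x| =
R`. -/
theorem exists_contDiff_eventuallyEq {F : Type*} [NormedAddCommGroup F] [NormedSpace ℝ F]
    [FiniteDimensional ℝ F] {ψ : F → ℝ} {z : F} (hψ : ContDiffAt ℝ 2 ψ z) :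
    ∃ ψ' : F → ℝ, ContDiff ℝ 2 ψ' ∧ ψ' =ᶠ[𝓝 z] ψ := by
  obtain ⟨ρ, hρ, hball⟩ := Metric.eventually_nhds_iff_ball.1 (hψ.eventually (by simp))
  let χ : ContDiffBump z := ⟨ρ / 4, ρ / 2, by positivity, by linarith⟩
  refine ⟨fun w => χ w * ψ w, ?_, ?_⟩
  · rw [contDiff_iff_contDiffAt]
    intro w
    by_cases hw : w ∈ Metric.ball z ρ
    · exact χ.contDiffAt.mul (hball w hw)
    · have : w ∉ tsupport χ := by
        rw [χ.tsupport_eq]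
        intro h
        apply hw
        rw [Metric.mem_closedBall] at h
        rw [Metric.mem_ball]
        have : χ.rOut = ρ / 2 := rfl
        linarith
      have h0 : (fun w => χ w * ψ w) =ᶠ[𝓝 w] fun _ => 0 := by
        filter_upwards [notMem_tsupport_iff_eventuallyEq.1 this] with v hv
        simp [hv]
      exact contDiffAt_const.congr_of_eventuallyEq h0
  · filter_upwards [χ.eventuallyEq_one] with w hw
    simp [hw]

theorem pLaplacian_congr {q : ℝ} {w w' : E → ℝ} {y : E} (h : w =ᶠ[𝓝 y] w') :
    pLaplacian q w y = pLaplacian q w' y := by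
  have h1 : gradient w =ᶠ[𝓝 y] gradient w' := by
    filter_upwards [h.fderiv (𝕜 := ℝ)] with x hx
    simp [gradient, hx]
  have h2 : (fun x => ‖gradient w x‖ ^ (q - 2) • gradient w x) =ᶠ[𝓝 y]
      fun x => ‖gradient w' x‖ ^ (q - 2) • gradient w' x := by
    filter_upwards [h1] with x hx
    rw [hx]
  simp only [pLaplacian, divergence, h2.fderiv_eq]

theorem partialDeriv_congr {w w' : E → ℝ} {y : E} (i : Fin n) (h : w =ᶠ[𝓝 y] w') :
    partialDeriv i w =ᶠ[𝓝 y] partialDeriv i w' := by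
  filter_upwards [h.fderiv (𝕜 := ℝ)] with x hx
  simp [partialDeriv, hx]

theorem inftyLaplacian_congr {w w' : E → ℝ} {y : E} (h : w =ᶠ[𝓝 y] w') :
    inftyLaplacian w y = inftyLaplacian w' y := by
  have h1 := fun i => partialDeriv_congr i h
  have h2 := fun i j => (partialDeriv_congr i (h1 j)).eq_of_nhds
  simp only [inftyLaplacian, h2, fun i => (h1 i).eq_of_nhds]

theorem gammaAt_congr {p : ℝ≥0∞} {c : ℝ} {ψ ψ' : E × ℝ → ℝ} {z : E × ℝ}
    (h : ψ =ᶠ[𝓝 z] ψ') : gammaAt p c ψ z = gammaAt p c ψ' z := by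
  have hx : (fun x => ψ (x, z.2)) =ᶠ[𝓝 z.1] fun x => ψ' (x, z.2) :=
    (Continuous.prodMk_left z.2).continuousAt.eventually h
  have ht : (fun t => ψ (z.1, t)) =ᶠ[𝓝 z.2] fun t => ψ' (z.1, t) :=
    (Continuous.prodMk_right z.1).continuousAt.eventually h
  simp only [gammaAt, pLaplacian_congr hx, inftyLaplacian_congr hx, ht.deriv_eq]

theorem IsSubsolution.gammaAt_nonneg {p : ℝ≥0∞} {T : ℝ} {u ψ : E × ℝ → ℝ}
    (hu : IsSubsolution p univ T u) {z : E × ℝ} (hz : z.2 ∈ Ioo 0 T) (hψ : ContDiffAt ℝ 2 ψ z)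
    (hle : ∀ᶠ w in 𝓝 z, u w ≤ ψ w) (heq : u z = ψ z) : 0 ≤ gammaAt p (u z) ψ z := by
  obtain ⟨ψ', hψ', he⟩ := exists_contDiff_eventuallyEq hψ
  rw [← gammaAt_congr he]
  refine hu.test ψ' (.of_contDiff hψ' T) z ⟨mem_univ _, hz⟩ ?_
  refine IsLocalMax.on ?_ _
  filter_upwards [hle, he] with w h1 h2
  rw [h2, he.eq_of_nhds, heq]
  linarith

theorem IsSupersolution.gammaAt_nonpos {p : ℝ≥0∞} {T : ℝ} {u ψ : E × ℝ → ℝ}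
    (hu : IsSupersolution p univ T u) {z : E × ℝ} (hz : z.2 ∈ Ioo 0 T) (hψ : ContDiffAt ℝ 2 ψ z)
    (hle : ∀ᶠ w in 𝓝 z, ψ w ≤ u w) (heq : u z = ψ z) : gammaAt p (u z) ψ z ≤ 0 := by
  obtain ⟨ψ', hψ', he⟩ := exists_contDiff_eventuallyEq hψ
  rw [← gammaAt_congr he]
  refine hu.test ψ' (.of_contDiff hψ' T) z ⟨mem_univ _, hz⟩ ?_
  refine IsLocalMin.on ?_ _
  filter_upwards [hle, he] with w h1 h2
  rw [h2, he.eq_of_nhds, heq]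
  linarith

/-! ### The operators on radial functions, in the variable `s = |x|²`. -/

theorem hasFDerivAt_radial {G : ℝ → ℝ} {G₁ : ℝ} {y : E} (hG : HasDerivAt G G₁ (‖y‖ ^ 2)) :
    HasFDerivAt (fun x : E => G (‖x‖ ^ 2)) ((2 * G₁) • innerSL ℝ y) y := by
  have h := hG.comp_hasFDerivAt y (hasStrictFDerivAt_norm_sq y).hasFDerivAt
  refine h.congr_fderiv ?_
  ext v
  simp [mul_comm, mul_assoc]

theorem gradient_radial {G : ℝ → ℝ} {G₁ : ℝ} {y : E} (hG : HasDerivAt G G₁ (‖y‖ ^ 2)) :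
    gradient (fun x : E => G (‖x‖ ^ 2)) y = (2 * G₁) • y := by
  rw [gradient, (hasFDerivAt_radial hG).fderiv, map_smulₛₗ]
  congr 1
  exact (InnerProductSpace.toDual ℝ E).symm_apply_apply y

theorem eventually_norm_sq {P : ℝ → Prop} {y : E} (h : ∀ᶠ s in 𝓝 (‖y‖ ^ 2), P s) :
    ∀ᶠ x : E in 𝓝 y, P (‖x‖ ^ 2) :=
  (continuous_norm.pow 2).continuousAt.eventually h

theorem divergence_radial {A : ℝ → ℝ} {A₁ : ℝ} {y : E} (hA : HasDerivAt A A₁ (‖y‖ ^ 2)) :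
    divergence (fun x : E => A (‖x‖ ^ 2) • x) y = n * A (‖y‖ ^ 2) + 2 * ‖y‖ ^ 2 * A₁ := by
  have h := (hasFDerivAt_radial hA).fun_smul (hasFDerivAt_id y)
  rw [divergence, show (fun x : E => A (‖x‖ ^ 2) • x) = fun x : E => A (‖x‖ ^ 2) • id x from rfl,
    h.fderiv]
  simp only [EuclideanSpace.norm_sq_eq, Real.norm_eq_abs, sq_abs, Finset.mul_sum, Finset.sum_mul]
  simp [Finset.sum_add_distrib, EuclideanSpace.inner_single_right]
  refine Finset.sum_congr rfl fun i _ => ?_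
  ring

/-- Since `x` vanishes at the origin, continuity of the coefficient `c` suffices there. This covers
powers of `|x|` that are not differentiable at `0`. -/
theorem divergence_smul_id_zero {c : E → ℝ} (hc : ContinuousAt c 0) :
    divergence (fun x : E => c x • x) 0 = n * c 0 := by
  have h : HasFDerivAt (fun x : E => c x • x) (c 0 • ContinuousLinearMap.id ℝ E) 0 := by
    rw [hasFDerivAt_iff_isLittleO_nhds_zero]
    have h1 : (fun x : E => c x - c 0) =o[𝓝 0] fun _ => (1 : ℝ) := by
      rw [isLittleO_one_iff]
      simpa using hc.sub_const (c 0)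
    have h2 := h1.smul_isBigO (isBigO_refl (fun x : E => x) (𝓝 0))
    simpa [sub_smul] using h2
  rw [divergence, h.fderiv]
  simp

/-- The `q`-Laplacian of a radial function `G (|x|²)`. -/
theorem pLaplacian_radial {q : ℝ} (hq : 2 ≤ q) {G G₁ : ℝ → ℝ} {G₂ : ℝ} {y : E}
    (hG : ∀ᶠ s in 𝓝 (‖y‖ ^ 2), HasDerivAt G (G₁ s) s) (hG₁ : HasDerivAt G₁ G₂ (‖y‖ ^ 2))
    (hne : G₁ (‖y‖ ^ 2) ≠ 0) :
    pLaplacian q (fun x : E => G (‖x‖ ^ 2)) y =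
      (4 * G₁ (‖y‖ ^ 2) ^ 2 * ‖y‖ ^ 2) ^ ((q - 2) / 2) *
        (2 * (n + q - 2) * G₁ (‖y‖ ^ 2) + 4 * (q - 1) * ‖y‖ ^ 2 * G₂) := by
  let A : ℝ → ℝ := fun s => (4 * G₁ s ^ 2 * s) ^ ((q - 2) / 2) * (2 * G₁ s)
  have hV : (fun x : E => ‖gradient (fun x : E => G (‖x‖ ^ 2)) x‖ ^ (q - 2) •
      gradient (fun x : E => G (‖x‖ ^ 2)) x) =ᶠ[𝓝 y] fun x => A (‖x‖ ^ 2) • x := by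
    filter_upwards [eventually_norm_sq hG] with x hx
    rw [gradient_radial hx, smul_smul]
    congr 2
    rw [show (4 * G₁ (‖x‖ ^ 2) ^ 2 * ‖x‖ ^ 2) = ‖(2 * G₁ (‖x‖ ^ 2)) • x‖ ^ (2 : ℝ) by
      rw [norm_smul, Real.rpow_two, mul_pow, Real.norm_eq_abs, sq_abs]; ring,
      ← Real.rpow_mul (norm_nonneg _)]
    congr 1
    ring
  rw [pLaplacian, divergence, hV.fderiv_eq, ← divergence]
  by_cases hy : y = 0
  · subst hy
    have hc : ContinuousAt (fun x : E => A (‖x‖ ^ 2)) 0 := by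
      have hA : ContinuousAt A (‖(0 : E)‖ ^ 2) := by
        refine ContinuousAt.mul ?_ (continuousAt_const.mul hG₁.continuousAt)
        exact ((continuousAt_const.mul (hG₁.continuousAt.pow 2)).mul continuousAt_id).rpow_const
          (Or.inr (by linarith))
      exact hA.comp (f := fun x : E => ‖x‖ ^ 2) (continuous_norm.pow 2).continuousAt
    rw [divergence_smul_id_zero hc]
    -- At the origin the power has base `0`: for `q = 2` it is `0 ^ 0 = 1`, and for `q > 2` both
    -- sides vanish.
    rcases hq.eq_or_lt with rfl | hq
    · simp [A]
      ring
    · have : (q - 2) / 2 ≠ 0 := by linarith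
      simp [A, Real.zero_rpow this]
  · have hs : 0 < ‖y‖ ^ 2 := by positivity
    set s := ‖y‖ ^ 2 with hs_def
    have hB : 0 < 4 * G₁ s ^ 2 * s := by positivity
    have hA := (((((hG₁.pow 2).const_mul 4).mul (hasDerivAt_id s)).rpow_const (p := (q - 2) / 2)
      (Or.inl hB.ne')).mul (hG₁.const_mul 2))
    have := divergence_radial (y := y) hA
    simp only [Pi.mul_apply, Pi.pow_apply, id] at this
    refine this.trans ?_
    rw [← hs_def, Real.rpow_sub_one hB.ne']
    set X := (4 * G₁ s ^ 2 * s) ^ ((q - 2) / 2)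
    field_simp
    ring

/-- The infinity-Laplacian of a radial function `G (|x|²)`. -/
theorem inftyLaplacian_radial {G G₁ : ℝ → ℝ} {G₂ : ℝ} {y : E}
    (hG : ∀ᶠ s in 𝓝 (‖y‖ ^ 2), HasDerivAt G (G₁ s) s) (hG₁ : HasDerivAt G₁ G₂ (‖y‖ ^ 2)) :
    inftyLaplacian (fun x : E => G (‖x‖ ^ 2)) y =
      4 * G₁ (‖y‖ ^ 2) ^ 2 * ‖y‖ ^ 2 * (2 * G₁ (‖y‖ ^ 2) + 4 * ‖y‖ ^ 2 * G₂) := by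
  have h1 : ∀ i : Fin n, partialDeriv i (fun x : E => G (‖x‖ ^ 2)) =ᶠ[𝓝 y]
      fun x => 2 * G₁ (‖x‖ ^ 2) * x i := by
    intro i
    filter_upwards [eventually_norm_sq hG] with x hx
    rw [partialDeriv, (hasFDerivAt_radial hx).fderiv]
    simp [EuclideanSpace.inner_single_right]
  have h2 : ∀ i j : Fin n, partialDeriv i (partialDeriv j (fun x : E => G (‖x‖ ^ 2))) y =
      4 * G₂ * y i * y j + if i = j then 2 * G₁ (‖y‖ ^ 2) else 0 := by
    intro i j
    rw [(partialDeriv_congr i (h1 j)).eq_of_nhds]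
    have h : HasFDerivAt (fun x : E => 2 * G₁ (‖x‖ ^ 2) * x j) _ y :=
      ((hasFDerivAt_radial hG₁).const_mul 2).fun_mul
      (EuclideanSpace.proj j : E →L[ℝ] ℝ).hasFDerivAt (x := y)
    rw [partialDeriv, h.fderiv]
    by_cases hij : i = j
    · subst hij
      simp [EuclideanSpace.inner_single_right]
      ring
    · simp [EuclideanSpace.inner_single_right, hij, Ne.symm hij]
      ring
  have hs : ‖y‖ ^ 2 = ∑ i, y i ^ 2 := by
    simp [EuclideanSpace.norm_sq_eq]
  simp only [inftyLaplacian, h2, fun i => (h1 i).eq_of_nhds]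
  set g := G₁ (‖y‖ ^ 2)
  have e : ∀ i j : Fin n, 2 * g * y i * (2 * g * y j) *
      (4 * G₂ * y i * y j + if i = j then 2 * g else 0) =
      16 * g ^ 2 * G₂ * (y i ^ 2 * y j ^ 2) + if i = j then 8 * g ^ 3 * y i ^ 2 else 0 := by
    intro i j
    split_ifs with h
    · subst h; ring
    · ring
  simp only [e, Finset.sum_add_distrib, Finset.sum_ite_eq, Finset.mem_univ, if_true,
    ← Finset.mul_sum, ← Finset.sum_mul, ← hs]
  ring

/-! ### Logarithmic form of the equation, uniformly in `p`. -/

/-- `C, κ, K, q` are the constants for which the operator `Γ_p` takes on `exp (l (|x|²) + …)`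
the form given in the field `gammaAt_exp`. -/
structure RadialConstants (n : ℕ) (p : ℝ≥0∞) where
  q : ℝ
  C : ℝ
  κ : ℝ
  K : ℝ
  two_le_q : 2 ≤ q
  C_nonneg : 0 ≤ C
  κ_pos : 0 < κ
  K_pos : 0 < K
  growth : growthExponent p = q / (q - 1)
  gammaAt_exp : ∀ (v : ℝ → ℝ → ℝ) (v₁ : ℝ → ℝ) (v₂ v' : ℝ) (z : EuclideanSpace ℝ (Fin n) × ℝ),
    (∀ᶠ s in 𝓝 (‖z.1‖ ^ 2), HasDerivAt (fun s => v s z.2) (v₁ s) s) →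
    HasDerivAt v₁ v₂ (‖z.1‖ ^ 2) → v₁ (‖z.1‖ ^ 2) ≠ 0 →
    HasDerivAt (v (‖z.1‖ ^ 2)) v' z.2 →
    gammaAt p (Real.exp (v (‖z.1‖ ^ 2) z.2)) (fun w => Real.exp (v (‖w.1‖ ^ 2) w.2)) z =
      Real.exp (v (‖z.1‖ ^ 2) z.2) ^ (q - 1) *
        ((4 * v₁ (‖z.1‖ ^ 2) ^ 2 * ‖z.1‖ ^ 2) ^ ((q - 2) / 2) *
          (2 * C * v₁ (‖z.1‖ ^ 2) + 4 * κ * ‖z.1‖ ^ 2 * (v₂ + v₁ (‖z.1‖ ^ 2) ^ 2)) - K * v')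

theorem nonempty_radialConstants {p : ℝ≥0∞} (hp : 2 ≤ p) : Nonempty (RadialConstants n p) := by
  have hexp : ∀ (v : ℝ → ℝ → ℝ) (v₁ : ℝ → ℝ) (v₂ : ℝ) (z : E × ℝ),
      (∀ᶠ s in 𝓝 (‖z.1‖ ^ 2), HasDerivAt (fun s => v s z.2) (v₁ s) s) →
      HasDerivAt v₁ v₂ (‖z.1‖ ^ 2) →
      (∀ᶠ s in 𝓝 (‖z.1‖ ^ 2), HasDerivAt (fun s => Real.exp (v s z.2))
        (Real.exp (v s z.2) * v₁ s) s) ∧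
      HasDerivAt (fun s => Real.exp (v s z.2) * v₁ s)
        (Real.exp (v (‖z.1‖ ^ 2) z.2) * (v₂ + v₁ (‖z.1‖ ^ 2) ^ 2)) (‖z.1‖ ^ 2) := by
    intro v v₁ v₂ z h h₁
    refine ⟨h.mono fun s hs => hs.exp, (h.self_of_nhds.exp.mul h₁).congr_deriv ?_⟩
    ring
  by_cases hpt : p = ∞
  -- `Δ_∞` is homogeneous of degree `3 = q - 1`, hence `q = 4`; this also explains the growth
  -- exponent `4/3`.
  · refine ⟨⟨4, 1, 1, 3, by norm_num, by norm_num, by norm_num, by norm_num, ?_, ?_⟩⟩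
    · rw [growthExponent, if_pos hpt]; norm_num
    · intro v v₁ v₂ v' z h h₁ hne ht
      obtain ⟨e1, e2⟩ := hexp v v₁ v₂ z h h₁
      rw [gammaAt, if_pos hpt, inftyLaplacian_radial (G := fun s => Real.exp (v s z.2)) e1 e2,
        ht.exp.deriv]
      norm_num
      ring
  · have hq : 2 ≤ p.toReal := by
      simpa using (ENNReal.toReal_le_toReal (by simp) hpt).2 hp
    refine ⟨⟨p.toReal, n + p.toReal - 2, p.toReal - 1, p.toReal - 1, hq, ?_, by linarith,
      by linarith, ?_, ?_⟩⟩
    · have : (0 : ℝ) ≤ n := n.cast_nonneg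
      linarith
    · rw [growthExponent, if_neg hpt]
    · intro v v₁ v₂ v' z h h₁ hne ht
      obtain ⟨e1, e2⟩ := hexp v v₁ v₂ z h h₁
      rw [gammaAt, if_neg hpt, pLaplacian_radial (G := fun s => Real.exp (v s z.2)) hq e1 e2
        (mul_ne_zero (Real.exp_pos _).ne' hne), ht.exp.deriv]
      set q := p.toReal
      set φ := Real.exp (v (‖z.1‖ ^ 2) z.2)
      have hφ : 0 < φ := Real.exp_pos _
      set d := v₁ (‖z.1‖ ^ 2)
      have e3 : (4 * (φ * d) ^ 2 * ‖z.1‖ ^ 2) ^ ((q - 2) / 2) =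
          φ ^ (q - 2) * (4 * d ^ 2 * ‖z.1‖ ^ 2) ^ ((q - 2) / 2) := by
        rw [show 4 * (φ * d) ^ 2 * ‖z.1‖ ^ 2 = φ ^ (2 : ℝ) * (4 * d ^ 2 * ‖z.1‖ ^ 2) by
          rw [Real.rpow_two]; ring, Real.mul_rpow (by positivity) (by positivity),
          ← Real.rpow_mul hφ.le]
        congr 2
        ring
      have e4 : φ ^ (q - 1) = φ ^ (q - 2) * φ := by
        rw [← Real.rpow_add_one hφ.ne']; congr 1; ring
      rw [e3, e4]
      ring

/-- If `u ≤ exp v` up to a multiplicative constant near `z`, with equality at `z`, and `v` is a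
strict supersolution of the logarithmic equation at `z`, then `u` is no subsolution. -/
theorem RadialConstants.sub_test {p : ℝ≥0∞} (c : RadialConstants n p) {T : ℝ} {u : E × ℝ → ℝ}
    (hu : IsSubsolution p univ T u) {z : E × ℝ} (hz : z.2 ∈ Ioo 0 T)
    {v : ℝ → ℝ → ℝ} {v₁ : ℝ → ℝ} {v₂ v' : ℝ}
    (hv : ContDiffAt ℝ 2 (fun w : E × ℝ => v (‖w.1‖ ^ 2) w.2) z)
    (h₁ : ∀ᶠ s in 𝓝 (‖z.1‖ ^ 2), HasDerivAt (fun s => v s z.2) (v₁ s) s)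
    (h₂ : HasDerivAt v₁ v₂ (‖z.1‖ ^ 2)) (hne : v₁ (‖z.1‖ ^ 2) ≠ 0)
    (ht : HasDerivAt (v (‖z.1‖ ^ 2)) v' z.2)
    (hmax : ∀ᶠ w in 𝓝 z, u w * Real.exp (-v (‖w.1‖ ^ 2) w.2) ≤
      u z * Real.exp (-v (‖z.1‖ ^ 2) z.2)) :
    0 ≤ (4 * v₁ (‖z.1‖ ^ 2) ^ 2 * ‖z.1‖ ^ 2) ^ ((c.q - 2) / 2) *
          (2 * c.C * v₁ (‖z.1‖ ^ 2) + 4 * c.κ * ‖z.1‖ ^ 2 * (v₂ + v₁ (‖z.1‖ ^ 2) ^ 2))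
          - c.K * v' := by
  have hpos : 0 < u z := hu.pos z ⟨mem_univ _, hz⟩
  -- Adding the constant `B` to `v` makes `exp` of it touch `u` at `z` without changing any
  -- derivative of `v`.
  set B := Real.log (u z) - v (‖z.1‖ ^ 2) z.2 with hB
  have hBz : Real.exp (B + v (‖z.1‖ ^ 2) z.2) = u z := by
    rw [hB, sub_add_cancel, Real.exp_log hpos]
  have h := hu.gammaAt_nonneg (ψ := fun w => Real.exp (B + v (‖w.1‖ ^ 2) w.2)) hz
    (contDiffAt_const.add hv).exp ?_ hBz.symm
  · rw [← hBz, c.gammaAt_exp (fun s t => B + v s t) v₁ v₂ v' z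
      (h₁.mono fun s hs => hs.const_add B) h₂ hne (ht.const_add B)] at h
    exact nonneg_of_mul_nonneg_right h (by positivity)
  · filter_upwards [hmax] with w hw
    rw [hB, sub_add_eq_add_sub, add_sub_assoc, Real.exp_add, Real.exp_log hpos, sub_eq_add_neg,
      Real.exp_add, mul_left_comm]
    rw [Real.exp_neg, mul_inv_le_iff₀ (Real.exp_pos _)] at hw
    linarith

/-- The analogue of `RadialConstants.sub_test` for supersolutions. -/
theorem RadialConstants.super_test {p : ℝ≥0∞} (c : RadialConstants n p) {T : ℝ} {u : E × ℝ → ℝ}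
    (hu : IsSupersolution p univ T u) {z : E × ℝ} (hz : z.2 ∈ Ioo 0 T)
    {v : ℝ → ℝ → ℝ} {v₁ : ℝ → ℝ} {v₂ v' : ℝ}
    (hv : ContDiffAt ℝ 2 (fun w : E × ℝ => v (‖w.1‖ ^ 2) w.2) z)
    (h₁ : ∀ᶠ s in 𝓝 (‖z.1‖ ^ 2), HasDerivAt (fun s => v s z.2) (v₁ s) s)
    (h₂ : HasDerivAt v₁ v₂ (‖z.1‖ ^ 2)) (hne : v₁ (‖z.1‖ ^ 2) ≠ 0)
    (ht : HasDerivAt (v (‖z.1‖ ^ 2)) v' z.2)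
    (hmin : ∀ᶠ w in 𝓝 z, u z * Real.exp (-v (‖z.1‖ ^ 2) z.2) ≤
      u w * Real.exp (-v (‖w.1‖ ^ 2) w.2)) :
    (4 * v₁ (‖z.1‖ ^ 2) ^ 2 * ‖z.1‖ ^ 2) ^ ((c.q - 2) / 2) *
          (2 * c.C * v₁ (‖z.1‖ ^ 2) + 4 * c.κ * ‖z.1‖ ^ 2 * (v₂ + v₁ (‖z.1‖ ^ 2) ^ 2))
          - c.K * v' ≤ 0 := by
  have hpos : 0 < u z := hu.pos z ⟨mem_univ _, hz⟩
  set B := Real.log (u z) - v (‖z.1‖ ^ 2) z.2 with hB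
  have hBz : Real.exp (B + v (‖z.1‖ ^ 2) z.2) = u z := by
    rw [hB, sub_add_cancel, Real.exp_log hpos]
  have h := hu.gammaAt_nonpos (ψ := fun w => Real.exp (B + v (‖w.1‖ ^ 2) w.2)) hz
    (contDiffAt_const.add hv).exp ?_ hBz.symm
  · rw [← hBz, c.gammaAt_exp (fun s t => B + v s t) v₁ v₂ v' z
      (h₁.mono fun s hs => hs.const_add B) h₂ hne (ht.const_add B)] at h
    exact nonpos_of_mul_nonpos_right h (by positivity)
  · filter_upwards [hmin] with w hw
    rw [hB, sub_add_eq_add_sub, add_sub_assoc, Real.exp_add, Real.exp_log hpos, sub_eq_add_neg,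
      Real.exp_add, mul_left_comm]
    rw [Real.exp_neg (v (‖w.1‖ ^ 2) w.2), le_mul_inv_iff₀ (Real.exp_pos _)] at hw
    linarith

/-! ### Barrier inequalities. -/

theorem hasDerivAt_div_sub {η T t : ℝ} (ht : t < T) :
    HasDerivAt (fun t => η / (T - t)) (η / (T - t) ^ 2) t := by
  have h : T - t ≠ 0 := by linarith
  refine ((hasDerivAt_const t η).div ((hasDerivAt_id t).const_sub T) h).congr_deriv ?_
  simp

/-- The spatial part of the upper barrier, with `r = 1 + |x|²`. -/
theorem upper_barrier_bound {q C κ b s : ℝ} (hq : 2 ≤ q) (hC : 0 ≤ C) (hκ : 0 < κ) (hb : 0 < b)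
    (hs : 0 ≤ s) {γ v₁ v₂ : ℝ} (hγ : γ = q / (q - 1))
    (hv₁ : v₁ = b * (γ / 2 * (1 + s) ^ (γ / 2 - 1))) (hv₂ : v₂ ≤ 0) :
    (4 * v₁ ^ 2 * s) ^ ((q - 2) / 2) * (2 * C * v₁ + 4 * κ * s * (v₂ + v₁ ^ 2)) ≤
      C * (b * γ) ^ (q - 1) + κ * (b * γ) ^ q * (1 + s) ^ (γ / 2) := by
  have hq1 : 0 < q - 1 := by linarith
  have hγ0 : 0 < γ := by rw [hγ]; exact div_pos (by linarith) hq1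
  set r := 1 + s with hr
  have hr0 : 0 < r := by positivity
  have hrs : s ≤ r := by linarith
  set β := b * γ with hβ
  have hβ0 : 0 < β := by positivity
  have h1 : 2 * v₁ = β * r ^ (γ / 2 - 1) := by rw [hv₁, hβ]; ring
  have h2 : 4 * v₁ ^ 2 * r = β ^ (2 : ℝ) * r ^ (γ - 1) := by
    have e : r ^ (γ - 1) = r ^ (γ / 2 - 1) * r ^ (γ / 2 - 1) * r := by
      rw [← Real.rpow_add hr0, ← Real.rpow_add_one hr0.ne']
      congr 1; ring
    rw [e, Real.rpow_two]
    linear_combination (2 * v₁ * r + β * r ^ (γ / 2 - 1) * r) * h1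
  have hpre : (4 * v₁ ^ 2 * s) ^ ((q - 2) / 2) ≤ β ^ (q - 2) * r ^ ((γ - 1) * ((q - 2) / 2)) := by
    calc (4 * v₁ ^ 2 * s) ^ ((q - 2) / 2) ≤ (4 * v₁ ^ 2 * r) ^ ((q - 2) / 2) := by
          apply Real.rpow_le_rpow (by positivity) (by gcongr) (by linarith)
      _ = _ := by
          rw [h2, Real.mul_rpow (by positivity) (by positivity), ← Real.rpow_mul hβ0.le,
            ← Real.rpow_mul hr0.le]
          congr 2; ring
  have hbr : 2 * C * v₁ + 4 * κ * s * (v₂ + v₁ ^ 2) ≤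
      C * (β * r ^ (γ / 2 - 1)) + κ * (β ^ (2 : ℝ) * r ^ (γ - 1)) := by
    rw [← h1, ← h2]
    have : 4 * κ * s * (v₂ + v₁ ^ 2) ≤ 4 * κ * r * v₁ ^ 2 := by
      calc 4 * κ * s * (v₂ + v₁ ^ 2) ≤ 4 * κ * s * v₁ ^ 2 := by gcongr; linarith
        _ ≤ _ := by gcongr
    linarith
  -- For `γ = q/(q-1)` the powers of `r` cancel in the first-order term and add up to `γ/2` in the
  -- quadratic one.
  have e1 : r ^ ((γ - 1) * ((q - 2) / 2)) * r ^ (γ / 2 - 1) = 1 := by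
    rw [← Real.rpow_add hr0]
    refine Eq.trans ?_ (Real.rpow_zero r)
    congr 1
    rw [hγ]; field_simp; ring
  have e2 : r ^ ((γ - 1) * ((q - 2) / 2)) * r ^ (γ - 1) = r ^ (γ / 2) := by
    rw [← Real.rpow_add hr0]
    congr 1
    rw [hγ]; field_simp; ring
  have e3 : β ^ (q - 2) * β = β ^ (q - 1) := by
    rw [← Real.rpow_add_one hβ0.ne']; congr 1; ring
  have e4 : β ^ (q - 2) * β ^ (2 : ℝ) = β ^ q := by
    rw [← Real.rpow_add hβ0]; congr 1; ring
  calc _ ≤ (4 * v₁ ^ 2 * s) ^ ((q - 2) / 2) *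
        (C * (β * r ^ (γ / 2 - 1)) + κ * (β ^ (2 : ℝ) * r ^ (γ - 1))) := by gcongr
    _ ≤ (β ^ (q - 2) * r ^ ((γ - 1) * ((q - 2) / 2))) *
        (C * (β * r ^ (γ / 2 - 1)) + κ * (β ^ (2 : ℝ) * r ^ (γ - 1))) := by gcongr
    _ = _ := by
      rw [← e2, ← e3, ← e4]
      linear_combination C * β ^ (q - 2) * β * e1

/-- The spatial part of the lower barrier, with `ρ = R² - |x|²`. -/
theorem lower_barrier_bound {q C κ k R s : ℝ} (hq : 2 ≤ q) (hC : 0 ≤ C) (hk : 0 < k)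
    (hkC : 2 * κ * (k - 1) = C) (hR : 1 ≤ R) (hs : 0 ≤ s) (hsR : s < R ^ 2) :
    -((16 * k ^ 2) ^ ((q - 2) / 2) * (4 * C * k / R ^ 2)) ≤
      (4 * (-k / (R ^ 2 - s)) ^ 2 * s) ^ ((q - 2) / 2) * (2 * C * (-k / (R ^ 2 - s)) +
        4 * κ * s * (-k / (R ^ 2 - s) ^ 2 + (-k / (R ^ 2 - s)) ^ 2)) := by
  have hρ : 0 < R ^ 2 - s := by linarith
  have hR2 : 1 ≤ R ^ 2 := one_le_pow₀ hR
  set ρ := R ^ 2 - s with hρd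
  have e : 2 * C * (-k / ρ) + 4 * κ * s * (-k / ρ ^ 2 + (-k / ρ) ^ 2) =
      2 * C * k * (s - ρ) / ρ ^ 2 := by
    rw [← hkC]; field_simp; ring
  rw [e]
  -- The choice of `k` leaves the sign of `s - ρ`. Near the lateral boundary (`ρ ≤ s`) the sign is
  -- favourable; otherwise `ρ ≥ R²/2`, so the negative part is `O(R⁻²)`.
  rcases le_total ρ s with h | h
  · have h1 : 0 ≤ 2 * C * k * (s - ρ) / ρ ^ 2 :=
      div_nonneg (mul_nonneg (by positivity) (by linarith)) (by positivity)
    exact (neg_nonpos.2 (by positivity)).trans (by positivity)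
  · have hR0 : 0 < R ^ 2 := by linarith
    have hb : -(4 * C * k / R ^ 2) ≤ 2 * C * k * (s - ρ) / ρ ^ 2 := by
      have h1 : -(2 * C * k / ρ) ≤ 2 * C * k * (s - ρ) / ρ ^ 2 := by
        have : 2 * C * k * (s - ρ) / ρ ^ 2 = 2 * C * k * s / ρ ^ 2 - 2 * C * k / ρ := by
          field_simp
        have h0 : 0 ≤ 2 * C * k * s / ρ ^ 2 := by positivity
        linarith
      have h2 : 2 * C * k / ρ ≤ 4 * C * k / R ^ 2 := by
        rw [div_le_div_iff₀ hρ hR0]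
        have : R ^ 2 ≤ 2 * ρ := by linarith
        have hCk : 0 ≤ 2 * C * k := by positivity
        nlinarith
      linarith
    have hpre : (4 * (-k / ρ) ^ 2 * s) ^ ((q - 2) / 2) ≤ (16 * k ^ 2) ^ ((q - 2) / 2) := by
      apply Real.rpow_le_rpow (by positivity) _ (by linarith)
      rw [div_pow, neg_sq, mul_div_assoc', div_mul_eq_mul_div, div_le_iff₀ (by positivity)]
      have h4 : s ≤ 4 * ρ ^ 2 := by nlinarith
      have := mul_le_mul_of_nonneg_left h4 (by positivity : 0 ≤ 4 * k ^ 2)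
      linarith
    have h0 : 0 ≤ 4 * C * k / R ^ 2 := by positivity
    calc -((16 * k ^ 2) ^ ((q - 2) / 2) * (4 * C * k / R ^ 2))
        ≤ -((4 * (-k / ρ) ^ 2 * s) ^ ((q - 2) / 2) * (4 * C * k / R ^ 2)) := by gcongr
      _ = (4 * (-k / ρ) ^ 2 * s) ^ ((q - 2) / 2) * (-(4 * C * k / R ^ 2)) := by ring
      _ ≤ _ := by gcongr

/-- `expNegInvGlue` extends the factor `exp(-η/(T'-t))` continuously by `0` to `t = T'`, so that the
quotients below live on a compact cylinder. -/
theorem expNegInvGlue_div {η τ : ℝ} (hη : 0 < η) (hτ : 0 < τ) :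
    expNegInvGlue (τ / η) = Real.exp (-(η / τ)) := by
  rw [expNegInvGlue, if_neg (by simpa using div_pos hτ hη), inv_div]

theorem expNegInvGlue_le_one (x : ℝ) : expNegInvGlue x ≤ 1 := by
  rw [expNegInvGlue]
  split_ifs with h
  · exact zero_le_one
  · rw [Real.exp_le_one_iff]
    have := inv_pos.2 (not_le.1 h)
    linarith

theorem continuous_expNegInvGlue_sub_div (T η : ℝ) :
    Continuous fun w : E × ℝ => expNegInvGlue ((T - w.2) / η) :=
  (expNegInvGlue.contDiff (n := 0)).continuous.comp (by fun_prop)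

/-- The upper barrier is not touched from below by a subsolution. -/
theorem RadialConstants.not_touch_upper {p : ℝ≥0∞} (c : RadialConstants n p) {T T' η ε γ : ℝ}
    {u : E × ℝ → ℝ} (hu : IsSubsolution p univ T u) (hT' : T' < T) (hη : 0 < η) (hε : 0 < ε)
    (hγ : γ = c.q / (c.q - 1))
    (h1 : c.C * (ε * (1 + T') * γ) ^ (c.q - 1) < c.K * (η / T' ^ 2))
    (h2 : c.κ * (ε * (1 + T') * γ) ^ c.q ≤ c.K * ε)
    {z : E × ℝ} (hz : z.2 ∈ Ioo 0 T') :
    ¬ ∀ᶠ w in 𝓝 z, u w * Real.exp (-(η / (T' - w.2) + ε * (1 + w.2) * (1 + ‖w.1‖ ^ 2) ^ (γ / 2))) ≤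
      u z * Real.exp (-(η / (T' - z.2) + ε * (1 + z.2) * (1 + ‖z.1‖ ^ 2) ^ (γ / 2))) := by
  intro hmax
  obtain ⟨hz0, hzT⟩ := hz
  have hq := c.two_le_q
  have hq1 : 0 < c.q - 1 := by linarith
  have hγ0 : 0 < γ := by rw [hγ]; exact div_pos (by linarith) hq1
  -- This is where `q ≥ 2` makes the barrier exponent concave in `s`, so its second derivative can
  -- be dropped.
  have hγ2 : γ ≤ 2 := by rw [hγ, div_le_iff₀ hq1]; linarith
  set S := ‖z.1‖ ^ 2 with hS
  have hS0 : 0 ≤ S := by positivity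
  have hS1 : 0 < 1 + S := by positivity
  set b := ε * (1 + z.2) with hb
  have hb0 : 0 < b := by positivity
  have hd : ∀ a s : ℝ, 0 < 1 + s →
      HasDerivAt (fun s => (1 + s) ^ a) (a * (1 + s) ^ (a - 1)) s := fun a s hs =>
    (((hasDerivAt_id s).const_add 1).rpow_const (Or.inl hs.ne')).congr_deriv (by simp)
  have key := c.sub_test hu (z := z) ⟨hz0, hzT.trans hT'⟩
    (v := fun s t => η / (T' - t) + ε * (1 + t) * (1 + s) ^ (γ / 2))
    (v₁ := fun s => b * (γ / 2 * (1 + s) ^ (γ / 2 - 1)))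
    (v₂ := b * (γ / 2 * ((γ / 2 - 1) * (1 + S) ^ (γ / 2 - 1 - 1))))
    (v' := η / (T' - z.2) ^ 2 + ε * (1 + S) ^ (γ / 2)) ?_ ?_ ?_ ?_ ?_ hmax
  · have hbound := upper_barrier_bound (b := b) (s := S) hq c.C_nonneg c.κ_pos hb0 hS0 hγ rfl
      (v₂ := b * (γ / 2 * ((γ / 2 - 1) * (1 + S) ^ (γ / 2 - 1 - 1)))) (by
        have : (γ / 2 - 1) * (1 + S) ^ (γ / 2 - 1 - 1) ≤ 0 :=
          mul_nonpos_of_nonpos_of_nonneg (by linarith) (by positivity)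
        exact mul_nonpos_of_nonneg_of_nonpos hb0.le
          (mul_nonpos_of_nonneg_of_nonpos (by linarith) this))
    have hβ : b * γ ≤ ε * (1 + T') * γ := by rw [hb]; gcongr
    have e1 : c.C * (b * γ) ^ (c.q - 1) ≤ c.C * (ε * (1 + T') * γ) ^ (c.q - 1) :=
      mul_le_mul_of_nonneg_left (Real.rpow_le_rpow (by positivity) hβ hq1.le) c.C_nonneg
    have e2 : c.κ * (b * γ) ^ c.q * (1 + S) ^ (γ / 2) ≤ c.K * ε * (1 + S) ^ (γ / 2) :=
      mul_le_mul_of_nonneg_right ((mul_le_mul_of_nonneg_left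
        (Real.rpow_le_rpow (by positivity) hβ (by linarith)) c.κ_pos.le).trans h2) (by positivity)
    -- The time singularity supplies a strict margin, uniform in `z`.
    have e3 : c.K * (η / T' ^ 2) ≤ c.K * (η / (T' - z.2) ^ 2) := by
      have := c.K_pos.le
      have : 0 < T' - z.2 := by linarith
      gcongr
      linarith
    simp only [← hS] at key
    linarith
  · have : T' - z.2 ≠ 0 := by linarith
    have h3 : ContDiffAt ℝ 2 (fun w : E × ℝ => (1 + ‖w.1‖ ^ 2) ^ (γ / 2)) z :=
      (contDiffAt_const.add (contDiff_fst.contDiffAt.norm_sq ℝ)).rpow_const_of_ne hS1.ne'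
    exact (contDiffAt_const.div (contDiffAt_const.sub contDiffAt_snd) this).add
      ((contDiffAt_const.mul (contDiffAt_const.add contDiffAt_snd)).mul h3)
  · filter_upwards [lt_mem_nhds (show -1 < S by linarith)] with s hs
    exact ((hd (γ / 2) s (by linarith)).const_mul b).const_add _
  · exact ((hd (γ / 2 - 1) S hS1).const_mul (γ / 2)).const_mul b
  · positivity
  · refine ((hasDerivAt_div_sub hzT).add ((((hasDerivAt_id z.2).const_add 1).const_mul ε).mul_const
      ((1 + S) ^ (γ / 2)))).congr_deriv ?_
    simp

/-- The lower barrier is not touched from above by a supersolution. -/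
theorem RadialConstants.not_touch_lower {p : ℝ≥0∞} (c : RadialConstants n p) {T T' η k R : ℝ}
    {u : E × ℝ → ℝ} (hu : IsSupersolution p univ T u) (hT' : T' < T) (hη : 0 < η) (hk : 0 < k)
    (hkC : 2 * c.κ * (k - 1) = c.C) (hR : 1 ≤ R)
    (h1 : (16 * k ^ 2) ^ ((c.q - 2) / 2) * (4 * c.C * k / R ^ 2) < c.K * (η / T' ^ 2))
    {z : E × ℝ} (hz : z.2 ∈ Ioo 0 T') (hzR : ‖z.1‖ < R) :
    ¬ ∀ᶠ w in 𝓝 z, u z * Real.exp (-(-(η / (T' - z.2)) + k * Real.log (R ^ 2 - ‖z.1‖ ^ 2))) ≤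
      u w * Real.exp (-(-(η / (T' - w.2)) + k * Real.log (R ^ 2 - ‖w.1‖ ^ 2))) := by
  intro hmin
  obtain ⟨hz0, hzT⟩ := hz
  set S := ‖z.1‖ ^ 2 with hS
  have hS0 : 0 ≤ S := by positivity
  have hSR : S < R ^ 2 := by rw [hS]; gcongr
  have hd : ∀ s : ℝ, s < R ^ 2 → HasDerivAt (fun s => R ^ 2 - s) (-1) s := fun s _ =>
    (hasDerivAt_id s).const_sub (R ^ 2)
  have key := c.super_test hu (z := z) ⟨hz0, hzT.trans hT'⟩
    (v := fun s t => -(η / (T' - t)) + k * Real.log (R ^ 2 - s))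
    (v₁ := fun s => -k / (R ^ 2 - s)) (v₂ := -k / (R ^ 2 - S) ^ 2)
    (v' := -(η / (T' - z.2) ^ 2)) ?_ ?_ ?_ ?_ ?_ hmin
  · have hbound := lower_barrier_bound c.two_le_q c.C_nonneg hk hkC hR hS0 hSR
    have e3 : c.K * (η / T' ^ 2) ≤ c.K * (η / (T' - z.2) ^ 2) := by
      have := c.K_pos.le
      have : 0 < T' - z.2 := by linarith
      gcongr
      linarith
    simp only [← hS] at key
    linarith
  · have h2 : T' - z.2 ≠ 0 := by linarith
    have h3 : ContDiffAt ℝ 2 (fun w : E × ℝ => Real.log (R ^ 2 - ‖w.1‖ ^ 2)) z :=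
      (contDiffAt_const.sub (contDiff_fst.contDiffAt.norm_sq ℝ)).log (sub_pos.2 hSR).ne'
    exact (contDiffAt_const.div (contDiffAt_const.sub contDiffAt_snd) h2).neg.add
      (contDiffAt_const.mul h3)
  · filter_upwards [gt_mem_nhds hSR] with s hs
    refine ((((hd s hs).log (sub_pos.2 hs).ne').const_mul k).const_add _).congr_deriv ?_
    ring
  · have := (sub_pos.2 hSR).ne'
    refine ((hasDerivAt_const S (-k)).div (hd S hSR) this).congr_deriv ?_
    ring
  · exact div_ne_zero (by linarith) (sub_pos.2 hSR).ne'
  · exact (hasDerivAt_div_sub hzT).neg.add_const _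

/-! ### Comparison on bounded cylinders. -/

/-- A function on `closedBall 0 R × [0, T']` that is continuous and at most `1` on the parabolic
boundary and on the top is at most `1`, unless it has an interior local maximum. -/
theorem le_one_of_boundary {H : E × ℝ → ℝ} {R T' : ℝ}
    (hH : ContinuousOn H (Metric.closedBall (0 : E) R ×ˢ Icc 0 T'))
    (hbot : ∀ x : E, ‖x‖ ≤ R → H (x, 0) ≤ 1) (htop : ∀ x : E, ‖x‖ ≤ R → H (x, T') ≤ 1)
    (hside : ∀ x : E, ‖x‖ = R → ∀ t ∈ Icc 0 T', H (x, t) ≤ 1)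
    (hint : ∀ z : E × ℝ, ‖z.1‖ < R → z.2 ∈ Ioo 0 T' → 1 < H z → ¬ ∀ᶠ w in 𝓝 z, H w ≤ H z)
    {x : E} (hx : ‖x‖ ≤ R) {t : ℝ} (ht : t ∈ Icc 0 T') : H (x, t) ≤ 1 := by
  by_contra! hcon
  have hmem : (x, t) ∈ Metric.closedBall (0 : E) R ×ˢ Icc 0 T' := ⟨by simpa using hx, ht⟩
  obtain ⟨z, hz, hmax⟩ :=
    ((isCompact_closedBall (0 : E) R).prod isCompact_Icc).exists_isMaxOn ⟨_, hmem⟩ hH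
  have hz1 : 1 < H z := hcon.trans_le (hmax hmem)
  obtain ⟨y, s⟩ := z
  have hy : ‖y‖ ≤ R := by simpa using hz.1
  have hs : s ∈ Icc 0 T' := hz.2
  have hyR : ‖y‖ < R := hy.lt_of_ne fun h => hz1.not_ge (hside y h s hs)
  have hs0 : 0 < s := hs.1.lt_of_ne fun h => hz1.not_ge (h ▸ hbot y hy)
  have hsT : s < T' := hs.2.lt_of_ne fun h => hz1.not_ge (h ▸ htop y hy)
  refine hint (y, s) hyR ⟨hs0, hsT⟩ hz1 ?_
  have hnhds : Metric.closedBall (0 : E) R ×ˢ Icc 0 T' ∈ 𝓝 (y, s) :=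
    prod_mem_nhds (Metric.closedBall_mem_nhds_of_mem (by simpa using hyR)) (Icc_mem_nhds hs0 hsT)
  filter_upwards [hnhds] with w hw using hmax hw

theorem RadialConstants.le_upper_barrier {p : ℝ≥0∞} (c : RadialConstants n p) {T T' η ε γ M R : ℝ}
    {u : E × ℝ → ℝ} (hu : IsSubsolution p univ T u) (hcont : ContinuousOn u (univ ×ˢ Ico 0 T))
    (hT' : T' < T) (hη : 0 < η) (hε : 0 < ε)
    (hγ : γ = c.q / (c.q - 1))
    (h1 : c.C * (ε * (1 + T') * γ) ^ (c.q - 1) < c.K * (η / T' ^ 2))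
    (h2 : c.κ * (ε * (1 + T') * γ) ^ c.q ≤ c.K * ε)
    (hM : 0 < M) (h0 : ∀ x, u (x, 0) ≤ M)
    (hside : ∀ x : E, ‖x‖ = R → ∀ t ∈ Ico 0 T, u (x, t) ≤ M * Real.exp (ε * R ^ γ))
    {x : E} (hx : ‖x‖ ≤ R) {t : ℝ} (ht : t ∈ Ioo 0 T') :
    u (x, t) ≤ M * Real.exp (η / (T' - t) + ε * (1 + t) * (1 + ‖x‖ ^ 2) ^ (γ / 2)) := by
  have hT0 : 0 < T' := ht.1.trans ht.2
  let H : E × ℝ → ℝ := fun w => u w * (expNegInvGlue ((T' - w.2) / η) *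
    Real.exp (-(ε * (1 + w.2) * (1 + ‖w.1‖ ^ 2) ^ (γ / 2)))) / M
  have hR0 : 0 ≤ R := (norm_nonneg x).trans hx
  have hH : ∀ w : E × ℝ, w.2 < T' → H w = u w *
      Real.exp (-(η / (T' - w.2) + ε * (1 + w.2) * (1 + ‖w.1‖ ^ 2) ^ (γ / 2))) / M := by
    intro w hw
    simp only [H]
    rw [expNegInvGlue_div hη (by linarith), ← Real.exp_add, neg_add]
  have hγ0 : 0 < γ := by
    have := c.two_le_q
    rw [hγ]; exact div_pos (by linarith) (by linarith)
  -- Used with `B = 0` at the bottom and with `B = ε R^γ` on the lateral boundary.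
  have hfac : ∀ (B : ℝ) (w : E × ℝ), 0 ≤ B → u w ≤ M * Real.exp B →
      B ≤ ε * (1 + w.2) * (1 + ‖w.1‖ ^ 2) ^ (γ / 2) → H w ≤ 1 := by
    intro B w hB hw hB2
    rw [div_le_one hM]
    calc u w * (expNegInvGlue ((T' - w.2) / η) *
          Real.exp (-(ε * (1 + w.2) * (1 + ‖w.1‖ ^ 2) ^ (γ / 2))))
        ≤ (M * Real.exp B) * (1 * Real.exp (-B)) := by
          have := expNegInvGlue_le_one ((T' - w.2) / η)
          have := expNegInvGlue.nonneg ((T' - w.2) / η)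
          gcongr
      _ = M := by rw [one_mul, mul_assoc, ← Real.exp_add]; simp
  have hle : H (x, t) ≤ 1 := by
    refine le_one_of_boundary (R := R) (T' := T') ?_ ?_ ?_ ?_ ?_ hx (Ioo_subset_Icc_self ht)
    · refine ((hcont.mono ?_).mul (Continuous.continuousOn ?_)).div_const M
      · exact prod_mono (subset_univ _) (Icc_subset_Ico_right hT')
      · refine (continuous_expNegInvGlue_sub_div T' η).mul ?_
        have : Continuous fun w : E × ℝ => (1 + ‖w.1‖ ^ 2) ^ (γ / 2) :=
          Continuous.rpow_const (by fun_prop) fun _ => Or.inr (by positivity)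
        fun_prop
    · intro y _
      refine hfac 0 (y, 0) le_rfl (by simpa using h0 y) (by simp; positivity)
    · intro y _
      simp [H, expNegInvGlue.zero]
    · intro y hy s hs
      refine hfac (ε * R ^ γ) (y, s) (by positivity) (hside y hy s ⟨hs.1, hs.2.trans_lt hT'⟩) ?_
      have e : R ^ γ ≤ (1 + ‖y‖ ^ 2) ^ (γ / 2) := by
        rw [hy, show R ^ γ = (R ^ 2) ^ (γ / 2) by
          rw [← Real.rpow_natCast, ← Real.rpow_mul hR0]; congr 1; push_cast; ring]
        exact Real.rpow_le_rpow (by positivity) (by linarith) (by positivity)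
      have hs1 : 1 ≤ 1 + s := by linarith [hs.1]
      calc ε * R ^ γ = ε * 1 * R ^ γ := by ring
        _ ≤ ε * (1 + s) * (1 + ‖y‖ ^ 2) ^ (γ / 2) := by gcongr
    · intro z hzR hz hz1 hmax
      refine c.not_touch_upper hu hT' hη hε hγ h1 h2 hz ?_
      have hlt : ∀ᶠ w : E × ℝ in 𝓝 z, w.2 < T' :=
        continuous_snd.continuousAt.eventually (gt_mem_nhds hz.2)
      filter_upwards [hmax, hlt] with w hw hwT
      rw [hH w hwT, hH z hz.2] at hw
      exact (div_le_div_iff_of_pos_right hM).1 hw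
  rw [hH _ ht.2, div_le_one hM, Real.exp_neg, mul_inv_le_iff₀ (Real.exp_pos _)] at hle
  exact hle

theorem RadialConstants.lower_barrier_le {p : ℝ≥0∞} (c : RadialConstants n p) {T T' η k R m : ℝ}
    {u : E × ℝ → ℝ} (hu : IsSupersolution p univ T u) (hcont : ContinuousOn u (univ ×ˢ Ico 0 T))
    (hT' : T' < T) (hη : 0 < η) (hk : 0 < k)
    (hkC : 2 * c.κ * (k - 1) = c.C) (hR : 1 ≤ R)
    (h1 : (16 * k ^ 2) ^ ((c.q - 2) / 2) * (4 * c.C * k / R ^ 2) < c.K * (η / T' ^ 2))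
    (hm : 0 < m) (h0 : ∀ x, m ≤ u (x, 0))
    {x : E} (hx : ‖x‖ ≤ R) {t : ℝ} (ht : t ∈ Ioo 0 T') :
    m * (Real.exp (-(η / (T' - t))) * (1 - ‖x‖ ^ 2 / R ^ 2) ^ k) ≤ u (x, t) := by
  have hR0 : 0 < R := by linarith
  have hpos : ∀ w : E × ℝ, w.2 ∈ Icc 0 T' → 0 < u w := by
    rintro ⟨y, s⟩ ⟨hs0, hs⟩
    rcases hs0.eq_or_lt with h | h
    · simp only at h; subst h; exact hm.trans_le (h0 y)
    · exact hu.pos (y, s) ⟨mem_univ _, h, lt_of_le_of_lt hs hT'⟩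
  let h : E × ℝ → ℝ := fun w => (max 0 (1 - ‖w.1‖ ^ 2 / R ^ 2)) ^ k
  -- The barrier is divided by `u`, not conversely: it vanishes on the side and the top, and `u` is
  -- positive, so the quotient is continuous and a minimum of `u / barrier` becomes a maximum.
  let H : E × ℝ → ℝ := fun w => m * (expNegInvGlue ((T' - w.2) / η) * h w) / u w
  have hh : ∀ w : E × ℝ, ‖w.1‖ < R → h w = Real.exp (k * Real.log (R ^ 2 - ‖w.1‖ ^ 2)) *
      (R ^ 2) ^ (-k) := by
    intro w hw
    have hw2 : 0 < R ^ 2 - ‖w.1‖ ^ 2 := sub_pos.2 (by gcongr)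
    have e : 1 - ‖w.1‖ ^ 2 / R ^ 2 = (R ^ 2 - ‖w.1‖ ^ 2) / R ^ 2 := by field_simp
    simp only [h]
    rw [e, max_eq_right (by positivity), Real.div_rpow hw2.le (by positivity),
      Real.rpow_neg (by positivity), Real.rpow_def_of_pos hw2, mul_comm k, div_eq_mul_inv]
  have hle : H (x, t) ≤ 1 := by
    refine le_one_of_boundary (R := R) (T' := T') ?_ ?_ ?_ ?_ ?_ hx (Ioo_subset_Icc_self ht)
    · refine (Continuous.continuousOn ?_).div (hcont.mono ?_) ?_
      · refine continuous_const.mul ((continuous_expNegInvGlue_sub_div T' η).mul ?_)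
        exact Continuous.rpow_const (by fun_prop) fun _ => Or.inr hk.le
      · exact prod_mono (subset_univ _) (Icc_subset_Ico_right hT')
      · exact fun w hw => (hpos w hw.2).ne'
    · intro y _
      have hy0 := hpos (y, 0) ⟨le_rfl, (ht.1.trans ht.2).le⟩
      rw [div_le_one hy0]
      have e1 : h (y, 0) ≤ 1 := by
        refine Real.rpow_le_one (le_max_left _ _) (max_le zero_le_one ?_) hk.le
        have : 0 ≤ ‖y‖ ^ 2 / R ^ 2 := by positivity
        linarith
      have e2 : 0 ≤ h (y, 0) := Real.rpow_nonneg (le_max_left _ _) _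
      calc m * (expNegInvGlue ((T' - 0) / η) * h (y, 0)) ≤ m * 1 := by
            gcongr
            exact mul_le_one₀ (expNegInvGlue_le_one _) e2 e1
        _ ≤ u (y, 0) := by simpa using h0 y
    · intro y _
      simp [H, expNegInvGlue.zero]
    · intro y hy s _
      have : R ^ 2 / R ^ 2 = 1 := div_self (by positivity)
      simp [H, h, hy, this, Real.zero_rpow hk.ne']
    · intro z hzR hz hz1 hmax
      refine c.not_touch_lower hu hT' hη hk hkC hR h1 hz hzR ?_
      have hlt : ∀ᶠ w : E × ℝ in 𝓝 z, w.2 ∈ Ioo 0 T' :=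
        continuous_snd.continuousAt.eventually (Ioo_mem_nhds hz.1 hz.2)
      have hltR : ∀ᶠ w : E × ℝ in 𝓝 z, ‖w.1‖ < R :=
        continuous_fst.norm.continuousAt.eventually (gt_mem_nhds hzR)
      have hHw : ∀ w : E × ℝ, w.2 ∈ Ioo 0 T' → ‖w.1‖ < R →
          H w = m * (R ^ 2) ^ (-k) / (u w *
            Real.exp (-(-(η / (T' - w.2)) + k * Real.log (R ^ 2 - ‖w.1‖ ^ 2)))) := by
        intro w hw hwR
        have := (hpos w (Ioo_subset_Icc_self hw)).ne'
        simp only [H]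
        rw [hh w hwR, expNegInvGlue_div hη (by linarith [hw.2]), Real.exp_neg (_ + _),
          Real.exp_add]
        field_simp
      have hc : 0 < m * (R ^ 2) ^ (-k) := by positivity
      filter_upwards [hmax, hlt, hltR] with w hw hwT hwR
      rw [hHw w hwT hwR, hHw z hz hzR] at hw
      have hw0 := hpos w (Ioo_subset_Icc_self hwT)
      have hz0 := hpos z (Ioo_subset_Icc_self hz)
      exact (div_le_div_iff_of_pos_left hc (by positivity) (by positivity)).1 hw
  have hx1 : 0 ≤ 1 - ‖x‖ ^ 2 / R ^ 2 := by
    rw [sub_nonneg, div_le_one (by positivity)]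
    gcongr
  rw [div_le_one (hpos (x, t) (Ioo_subset_Icc_self ht))] at hle
  simp only [h] at hle
  rwa [max_eq_right hx1, expNegInvGlue_div hη (by linarith [ht.2])] at hle

/-! ### Choice of parameters and passage to the limit. -/

/-- Both conditions hold for small `ε` because `ε^(q-1) → 0`; the second is divided by `ε` first. -/
theorem RadialConstants.exists_eps {p : ℝ≥0∞} (c : RadialConstants n p) {T' η γ : ℝ}
    (hT' : 0 < T') (hη : 0 < η) (hγ : 0 < γ) :
    ∃ ε, 0 < ε ∧ ε ≤ η ∧ c.C * (ε * (1 + T') * γ) ^ (c.q - 1) < c.K * (η / T' ^ 2) ∧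
      c.κ * (ε * (1 + T') * γ) ^ c.q ≤ c.K * ε := by
  have hq1 : 0 < c.q - 1 := by linarith [c.two_le_q]
  have hK := c.K_pos
  have hlim : ∀ D : ℝ, Tendsto (fun ε : ℝ => D * (ε * (1 + T') * γ) ^ (c.q - 1))
      (𝓝[>] 0) (𝓝 0) := by
    intro D
    have hc : Continuous fun ε : ℝ => D * (ε * (1 + T') * γ) ^ (c.q - 1) :=
      continuous_const.mul (Continuous.rpow_const (by fun_prop) fun _ => Or.inr hq1.le)
    have := hc.tendsto 0
    simp only [zero_mul, Real.zero_rpow hq1.ne', mul_zero] at this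
    exact this.mono_left nhdsWithin_le_nhds
  have e1 := (hlim c.C).eventually (gt_mem_nhds (show 0 < c.K * (η / T' ^ 2) by positivity))
  have e2 := (hlim (c.κ * ((1 + T') * γ))).eventually (gt_mem_nhds hK)
  obtain ⟨ε, h1, h2, hε⟩ := (e1.and (e2.and (Ioc_mem_nhdsGT hη))).exists
  refine ⟨ε, hε.1, hε.2, h1, ?_⟩
  have hβ : 0 < ε * (1 + T') * γ := mul_pos (mul_pos hε.1 (by linarith)) hγ
  have e3 : (ε * (1 + T') * γ) ^ c.q =
      (ε * (1 + T') * γ) ^ (c.q - 1) * (ε * (1 + T') * γ) := by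
    rw [← Real.rpow_add_one hβ.ne']; congr 1; ring
  have := mul_le_mul_of_nonneg_right h2.le hε.1.le
  rw [e3]
  linarith

theorem RadialConstants.le_of_growth {p : ℝ≥0∞} (c : RadialConstants n p) {T M : ℝ}
    {u : E × ℝ → ℝ} (hu : IsSubsolution p univ T u) (hcont : ContinuousOn u (univ ×ˢ Ico 0 T))
    (hM : 0 < M) (h0 : ∀ x, u (x, 0) ≤ M) {g : ℝ → ℝ}
    (hg : g =o[atTop] fun R : ℝ => R ^ growthExponent p)
    (hug : ∀ᶠ R : ℝ in atTop, ∀ x : E, ‖x‖ ≤ R → ∀ t ∈ Ico 0 T, u (x, t) ≤ Real.exp (g R))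
    (x : E) {t : ℝ} (ht : t ∈ Ioo 0 T) : u (x, t) ≤ M := by
  obtain ⟨T', htT', hT'⟩ := exists_between ht.2
  have hT0 : 0 < T' := ht.1.trans htT'
  set γ := growthExponent p with hγ
  have hγ0 : 0 < γ := by
    have := c.two_le_q
    rw [hγ, c.growth]; exact div_pos (by linarith) (by linarith)
  have hbar : ∀ η : ℝ, 0 < η →
      u (x, t) ≤ M * Real.exp (η * (1 / (T' - t) + (1 + t) * (1 + ‖x‖ ^ 2) ^ (γ / 2))) := by
    intro η hη
    obtain ⟨ε, hε, hεη, h1, h2⟩ := c.exists_eps hT0 hη hγ0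
    have hRlim : Tendsto (fun R : ℝ => ε / 2 * R ^ γ) atTop atTop :=
      (tendsto_rpow_atTop hγ0).const_mul_atTop (by positivity)
    -- Half of `ε R^γ` absorbs `g R`; the other half absorbs `-log M`, which is positive when `M <
    -- 1`.
    obtain ⟨R, hRg, hRu, hRM, hRx, hR0⟩ := ((hg.bound (half_pos hε)).and (hug.and
      ((hRlim.eventually_ge_atTop (-Real.log M)).and
        ((eventually_ge_atTop ‖x‖).and (eventually_ge_atTop 0))))).exists
    have hgR : Real.exp (g R) ≤ M * Real.exp (ε * R ^ γ) := by
      have e : g R ≤ ε / 2 * R ^ γ := by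
        rw [Real.norm_of_nonneg (Real.rpow_nonneg hR0 _)] at hRg
        exact (le_abs_self _).trans hRg
      calc Real.exp (g R) ≤ Real.exp (Real.log M + ε * R ^ γ) :=
            Real.exp_le_exp.2 (by linarith)
        _ = _ := by rw [Real.exp_add, Real.exp_log hM]
    refine (c.le_upper_barrier hu hcont hT' hη hε c.growth h1 h2 hM h0
      (fun y hy s hs => (hRu y hy.le s hs).trans hgR) hRx ⟨ht.1, htT'⟩).trans ?_
    gcongr
    rw [mul_add η, mul_one_div, mul_assoc, ← hγ]
    have := ht.1.le
    gcongr
  have hlim : Tendsto (fun η : ℝ => M * Real.exp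
      (η * (1 / (T' - t) + (1 + t) * (1 + ‖x‖ ^ 2) ^ (γ / 2)))) (𝓝[>] 0) (𝓝 M) := by
    have hc : Continuous fun η : ℝ => M * Real.exp
      (η * (1 / (T' - t) + (1 + t) * (1 + ‖x‖ ^ 2) ^ (γ / 2))) := by fun_prop
    simpa using (hc.tendsto 0).mono_left nhdsWithin_le_nhds
  exact ge_of_tendsto hlim (eventually_mem_nhdsWithin.mono hbar)

theorem RadialConstants.le_of_initial_le {p : ℝ≥0∞} (c : RadialConstants n p) {T m : ℝ}
    {u : E × ℝ → ℝ} (hu : IsSupersolution p univ T u) (hcont : ContinuousOn u (univ ×ˢ Ico 0 T))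
    (hm : 0 < m) (h0 : ∀ x, m ≤ u (x, 0)) (x : E) {t : ℝ} (ht : t ∈ Ioo 0 T) :
    m ≤ u (x, t) := by
  obtain ⟨T', htT', hT'⟩ := exists_between ht.2
  have hT0 : 0 < T' := ht.1.trans htT'
  have hκ := c.κ_pos
  have hK := c.K_pos
  have hC := c.C_nonneg
  -- Solves `2κ(k-1) = C`, the cancellation required by `lower_barrier_bound`.
  set k := 1 + c.C / (2 * c.κ) with hk_def
  have hk : 0 < k := by positivity
  have hkC : 2 * c.κ * (k - 1) = c.C := by rw [hk_def]; field_simp; ring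
  have hbar : ∀ η : ℝ, 0 < η → m * Real.exp (-(η / (T' - t))) ≤ u (x, t) := by
    intro η hη
    have hsq : Tendsto (fun R : ℝ => R ^ 2) atTop atTop := tendsto_pow_atTop (by norm_num)
    have e1 : Tendsto (fun R : ℝ => (16 * k ^ 2) ^ ((c.q - 2) / 2) * (4 * c.C * k / R ^ 2))
        atTop (𝓝 0) := by
      simpa using (hsq.const_div_atTop (4 * c.C * k)).const_mul ((16 * k ^ 2) ^ ((c.q - 2) / 2))
    have e2 : Tendsto (fun R : ℝ => m * (Real.exp (-(η / (T' - t))) *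
        (1 - ‖x‖ ^ 2 / R ^ 2) ^ k)) atTop (𝓝 (m * Real.exp (-(η / (T' - t))))) := by
      have h1 : Tendsto (fun R : ℝ => 1 - ‖x‖ ^ 2 / R ^ 2) atTop (𝓝 1) := by
        simpa using (hsq.const_div_atTop (‖x‖ ^ 2)).const_sub 1
      simpa using ((h1.rpow_const (p := k) (Or.inl one_ne_zero)).const_mul
        (Real.exp (-(η / (T' - t))))).const_mul m
    refine le_of_tendsto e2 ?_
    filter_upwards [e1.eventually (gt_mem_nhds (show 0 < c.K * (η / T' ^ 2) by positivity)),
      eventually_ge_atTop 1, eventually_ge_atTop ‖x‖] with R hR1 hR hRx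
    exact c.lower_barrier_le hu hcont hT' hη hk hkC hR hR1 hm h0 hRx ⟨ht.1, htT'⟩
  have hlim : Tendsto (fun η : ℝ => m * Real.exp (-(η / (T' - t)))) (𝓝[>] 0) (𝓝 m) := by
    have hc : Continuous fun η : ℝ => m * Real.exp (-(η / (T' - t))) := by fun_prop
    simpa using (hc.tendsto 0).mono_left nhdsWithin_le_nhds
  exact le_of_tendsto hlim (eventually_mem_nhdsWithin.mono hbar)

end Trudinger

theorem theorem1p7 (n : ℕ) (hn : 2 ≤ n) (p : ℝ≥0∞) (hp : 2 ≤ p) (T : ℝ) (hT : 0 < T)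
    (f : EuclideanSpace ℝ (Fin n) → ℝ)
    (hf_inf : 0 < (⨅ x, f x)) (hf_sup : BddAbove (range f))
    (u : EuclideanSpace ℝ (Fin n) × ℝ → ℝ)
    (hu_cont : ContinuousOn u (univ ×ˢ Ico 0 T))
    (hu_sol : Trudinger.IsSolution p univ T u)
    (hu_init : ∀ x, u (x, 0) = f x)
    (hu_growth : ∃ g : ℝ → ℝ,
      g =o[atTop] (fun R : ℝ => R ^ Trudinger.growthExponent p) ∧
      ∀ᶠ R : ℝ in atTop, ∀ x : EuclideanSpace ℝ (Fin n), ‖x‖ ≤ R →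
        ∀ t ∈ Ico 0 T, u (x, t) ≤ Real.exp (g R)) :
    ∀ x : EuclideanSpace ℝ (Fin n), ∀ t ∈ Ioo 0 T,
      (⨅ y, f y) ≤ u (x, t) ∧ u (x, t) ≤ (⨆ y, f y) := by

  intro x t ht
  obtain ⟨c⟩ := Trudinger.nonempty_radialConstants (n := n) hp
  -- The real infimum of a set unbounded below is `0` by convention, so a positive infimum forces
  -- boundedness below.
  have hbdd : BddBelow (range f) := by
    by_contra h
    rw [Real.iInf_of_not_bddBelow h] at hf_inf
    exact hf_inf.false
  obtain ⟨g, hg, hug⟩ := hu_growth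
  have hle : (⨅ y, f y) ≤ ⨆ y, f y := (ciInf_le hbdd x).trans (le_ciSup hf_sup x)
  exact ⟨c.le_of_initial_le hu_sol.super hu_cont hf_inf
      (fun y => (ciInf_le hbdd y).trans (hu_init y).ge) x ht,
    c.le_of_growth hu_sol.sub hu_cont (hf_inf.trans_le hle)
      (fun y => (hu_init y).le.trans (le_ciSup hf_sup y)) hg hug x ht⟩
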